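/- Let $f(q)=\sum_{n\ge 1}a_n q^n\in q\,\mathbb{Z}[[q]]$ be a non-zero power series of order $\alpha$, i.e. $\alpha\ge 1$ is the smallest integer with $a_\alpha\neq 0$. For an integer $N\ge 0$, let $dU$ be the Haar measure on the unitary group $U(N)$, normalized to total volume $1$, and define $$I^f_N(q)=\int_{U(N)}\exp\Bigl(\sum_{k=1}^{\infty}\frac1k\,f(q^k)\,\operatorname{Tr}U^k\,\operatorname{Tr}U^{-k}\Bigr)\,dU=\sum_{\ell\ge 0}d^f_N(\ell)\,q^\ell ,$$ where the integrand is understood as a formal power series in $q$ and is integrated coefficient by coefficient. Define also $$I^f_\infty(q)=\prod_{k=1}^{\infty}\frac{1}{1-f(q^k)}=\sum_{\ell\ge 0}d^f_\infty(\ell)\,q^\ell\in\mathbb{Z}[[q]].$$ Then $$d^f_N(\ell)=d^f_\infty(\ell)\qquad\text{for all integers } 0\le \ell\le \alpha N .$$ -/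

import Mathlib

open scoped PowerSeries PowerSeries.WithPiTopology

noncomputable section

namespace UnitaryMatrixIntegral

/-! ### The unitary group with its normalized invariant measure -/

/-- The group of unitary `N × N` matrices, with the topology inherited from the space of matrices. -/
abbrev U (N : ℕ) : Type := Matrix.unitaryGroup (Fin N) ℂ

instance instCompactSpaceU (N : ℕ) : CompactSpace (U N) := by
  have hsub : (Matrix.unitaryGroup (Fin N) ℂ : Set (Matrix (Fin N) (Fin N) ℂ)) ⊆
      Set.pi Set.univ (fun _ => Set.pi Set.univ fun _ => Metric.closedBall (0 : ℂ) 1) := by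
    intro A hA i _ j _
    simpa using entry_norm_bound_of_unitary hA i j
  have hK : IsCompact (Set.pi Set.univ (fun _ : Fin N => Set.pi Set.univ
      fun _ : Fin N => Metric.closedBall (0 : ℂ) 1)) :=
    isCompact_univ_pi fun _ => isCompact_univ_pi fun _ => isCompact_closedBall _ _
  have hcl : IsClosed (Matrix.unitaryGroup (Fin N) ℂ : Set (Matrix (Fin N) (Fin N) ℂ)) :=
    isClosed_unitary
  exact isCompact_iff_compactSpace.mp (hK.of_isClosed_subset hcl hsub)

/-- The unitary group carries its Borel σ-algebra. -/
instance instMeasurableSpaceU (N : ℕ) : MeasurableSpace (U N) := borel _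

instance instBorelSpaceU (N : ℕ) : BorelSpace (U N) := ⟨rfl⟩

/-- The invariant (Haar) measure `dU` on `U(N)` of total volume `1`. -/
def haarU (N : ℕ) : MeasureTheory.Measure (U N) := MeasureTheory.Measure.haarMeasure ⊤

instance instIsHaarMeasureHaarU (N : ℕ) : (haarU N).IsHaarMeasure := by
  unfold haarU; infer_instance

instance instIsProbabilityMeasureHaarU (N : ℕ) : MeasureTheory.IsProbabilityMeasure (haarU N) :=
  ⟨by
    have h := MeasureTheory.Measure.haarMeasure_self
      (K₀ := (⊤ : TopologicalSpace.PositiveCompacts (U N)))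
    simpa [haarU] using h⟩

/-- `Tr U^k` for an integer exponent `k`, possibly negative. -/
def trPow {N : ℕ} (u : U N) (k : ℤ) : ℂ := Matrix.trace ((u ^ k : U N) : Matrix (Fin N) (Fin N) ℂ)

/-! ### The finite-`N` integral, as a formal power series in `q` -/

/-- `f(q^k)`, for `k ≥ 1`, where `k` is written as `j + 1`. -/
def atPow {R : Type*} [CommRing R] (f : R⟦X⟧) (j : ℕ) : R⟦X⟧ :=
  PowerSeries.expand (j + 1) j.succ_ne_zero f

/-- The summand `(1/k) f(q^k) Tr U^k Tr U^{-k}` of the exponent, where `k = j + 1`. -/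
def actionTerm {N : ℕ} (f : ℤ⟦X⟧) (u : U N) (j : ℕ) : ℂ⟦X⟧ :=
  ((1 / ((j + 1 : ℕ) : ℂ)) * (trPow u ((j + 1 : ℕ) : ℤ) * trPow u (-((j + 1 : ℕ) : ℤ)))) •
    PowerSeries.map (Int.castRingHom ℂ) (atPow f j)

/-- The exponent `∑_{k ≥ 1} (1/k) f(q^k) Tr U^k Tr U^{-k}`, a power series in `q`. The sum is taken
in the topology of coefficientwise convergence; see `hasSum_action`. -/
def action {N : ℕ} (f : ℤ⟦X⟧) (u : U N) : ℂ⟦X⟧ := ∑' j : ℕ, actionTerm f u j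

/-- The integrand `exp (∑_{k ≥ 1} (1/k) f(q^k) Tr U^k Tr U^{-k})`, the formal exponential of a power
series in `q` without constant term. -/
def integrand {N : ℕ} (f : ℤ⟦X⟧) (u : U N) : ℂ⟦X⟧ := (PowerSeries.exp ℂ).subst (action f u)

/-- The power series `I^f_N(q) = ∫_{U(N)} exp (∑_{k ≥ 1} (1/k) f(q^k) Tr U^k Tr U^{-k}) dU`,
integrated coefficient by coefficient. -/
def I (N : ℕ) (f : ℤ⟦X⟧) : ℂ⟦X⟧ :=
  PowerSeries.mk fun l => ∫ u : U N, PowerSeries.coeff l (integrand f u) ∂(haarU N)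

/-- The `q`-series coefficient `d^f_N(l)` of the integral. -/
def d (N : ℕ) (f : ℤ⟦X⟧) (l : ℕ) : ℂ := PowerSeries.coeff l (I N f)

/-! ### The infinite-`N` series -/

/-- `1 / (1 - f(q^k))`, where `k = j + 1` and `f` has no constant term; see `one_sub_mul_factor`. -/
def factor (f : ℤ⟦X⟧) (j : ℕ) : ℤ⟦X⟧ := PowerSeries.invOfUnit (1 - atPow f j) 1

/-- `I^f_∞(q) = ∏_{k ≥ 1} 1 / (1 - f(q^k))`, a product of power series in the topology of
coefficientwise convergence (the coefficient ring `ℤ` is discrete); see `multipliable_factor`. -/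
def Iinf (f : ℤ⟦X⟧) : ℤ⟦X⟧ := ∏' j : ℕ, factor f j

/-- The `q`-series coefficient `d^f_∞(l)` of the infinite-`N` series. -/
def dinf (f : ℤ⟦X⟧) (l : ℕ) : ℤ := PowerSeries.coeff l (Iinf f)

/-! ### The sums, products and integrals above are the genuine ones -/

theorem coeff_atPow_eq_zero {R : Type*} [CommRing R] {f : R⟦X⟧}
    (hf : PowerSeries.constantCoeff f = 0) {n j : ℕ} (h : n < j + 1) :
    PowerSeries.coeff n (atPow f j) = 0 := by
  unfold atPow
  rcases Nat.eq_zero_or_pos n with rfl | hn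
  · rw [PowerSeries.coeff_zero_eq_constantCoeff_apply, PowerSeries.constantCoeff_expand, hf]
  · exact PowerSeries.coeff_expand_of_not_dvd _ _ _ (Nat.not_dvd_of_pos_of_lt hn h)

theorem coeff_actionTerm_eq_zero {N : ℕ} {f : ℤ⟦X⟧} (hf : PowerSeries.constantCoeff f = 0)
    (u : U N) {n j : ℕ} (h : n < j + 1) : PowerSeries.coeff n (actionTerm f u j) = 0 := by
  simp [actionTerm, coeff_atPow_eq_zero hf h]

theorem hasSum_coeff_actionTerm {N : ℕ} {f : ℤ⟦X⟧} (hf : PowerSeries.constantCoeff f = 0)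
    (u : U N) (n : ℕ) : HasSum (fun j => PowerSeries.coeff n (actionTerm f u j))
      (∑ j ∈ Finset.range n, PowerSeries.coeff n (actionTerm f u j)) :=
  hasSum_sum_of_ne_finset_zero fun j hj =>
    coeff_actionTerm_eq_zero hf u (by simp at hj; omega)

theorem hasSum_action {N : ℕ} {f : ℤ⟦X⟧} (hf : PowerSeries.constantCoeff f = 0) (u : U N) :
    HasSum (actionTerm f u) (action f u) :=
  Summable.hasSum ((PowerSeries.WithPiTopology.summable_iff_summable_coeff ℂ).2
    fun n => (hasSum_coeff_actionTerm hf u n).summable)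

theorem coeff_action {N : ℕ} {f : ℤ⟦X⟧} (hf : PowerSeries.constantCoeff f = 0) (u : U N) (n : ℕ) :
    PowerSeries.coeff n (action f u) =
      ∑ j ∈ Finset.range n, PowerSeries.coeff n (actionTerm f u j) :=
  ((PowerSeries.WithPiTopology.hasSum_iff_hasSum_coeff ℂ).1 (hasSum_action hf u) n).unique
    (hasSum_coeff_actionTerm hf u n)

theorem constantCoeff_action {N : ℕ} {f : ℤ⟦X⟧} (hf : PowerSeries.constantCoeff f = 0) (u : U N) :
    PowerSeries.constantCoeff (action f u) = 0 := by
  rw [← PowerSeries.coeff_zero_eq_constantCoeff_apply, coeff_action hf]; simp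

theorem coeff_integrand {N : ℕ} {f : ℤ⟦X⟧} (hf : PowerSeries.constantCoeff f = 0) (u : U N)
    (l : ℕ) : PowerSeries.coeff l (integrand f u) =
      ∑ m ∈ Finset.range (l + 1),
        (1 / (m.factorial : ℂ)) * PowerSeries.coeff l (action f u ^ m) := by
  have h0 := constantCoeff_action hf u
  rw [integrand, PowerSeries.coeff_subst' (PowerSeries.HasSubst.of_constantCoeff_zero' h0)]
  rw [finsum_eq_sum_of_support_subset (s := Finset.range (l + 1))]
  · simp [smul_eq_mul]
  · intro m hm
    by_contra hlt
    apply hm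
    have : l < m := by simpa using hlt
    have hz : PowerSeries.coeff l (action f u ^ m) = 0 := by
      apply PowerSeries.coeff_of_lt_order
      exact lt_of_lt_of_le (by exact_mod_cast this)
        (PowerSeries.le_order_pow_of_constantCoeff_eq_zero m h0)
    simp [hz]

theorem continuous_trPow {N : ℕ} (k : ℤ) : Continuous fun u : U N => trPow u k := by
  have : Continuous fun u : U N => ((u ^ k : U N) : Matrix (Fin N) (Fin N) ℂ) :=
    continuous_subtype_val.comp (continuous_zpow k)
  exact this.matrix_trace

/-- Every coefficient of the integrand is a continuous function on `U(N)`. -/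
theorem continuous_coeff_integrand {N : ℕ} {f : ℤ⟦X⟧} (hf : PowerSeries.constantCoeff f = 0)
    (l : ℕ) : Continuous fun u : U N => PowerSeries.coeff l (integrand f u) := by
  have hS : Continuous fun u : U N => action f u := by
    refine continuous_pi fun e => ?_
    have key : Continuous fun u : U N => PowerSeries.coeff (e ()) (action f u) := by
      simp only [coeff_action hf, actionTerm, PowerSeries.coeff_smul, smul_eq_mul]
      refine continuous_finsetSum _ fun j _ => ?_
      exact (continuous_const.mul ((continuous_trPow _).mul (continuous_trPow _))).mul
        continuous_const
    have he : e = Finsupp.single () (e ()) := by ext; simp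
    rw [he]
    exact key
  simp only [coeff_integrand hf]
  refine continuous_finsetSum _ fun m _ => continuous_const.mul ?_
  exact (PowerSeries.WithPiTopology.continuous_coeff ℂ l).comp (hS.pow m)

theorem integrable_coeff_integrand {N : ℕ} {f : ℤ⟦X⟧} (hf : PowerSeries.constantCoeff f = 0)
    (l : ℕ) : MeasureTheory.Integrable
      (fun u : U N => PowerSeries.coeff l (integrand f u)) (haarU N) :=
  (continuous_coeff_integrand hf l).integrable_of_hasCompactSupport
    (HasCompactSupport.of_compactSpace _)

theorem one_sub_mul_factor {f : ℤ⟦X⟧} (hf : PowerSeries.constantCoeff f = 0) (j : ℕ) :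
    (1 - atPow f j) * factor f j = 1 := by
  refine PowerSeries.mul_invOfUnit _ _ ?_
  simp [atPow, PowerSeries.constantCoeff_expand, hf]

theorem multipliable_factor {f : ℤ⟦X⟧} (hf : PowerSeries.constantCoeff f = 0) :
    Multipliable (factor f) := by
  have h : factor f = fun j => 1 + atPow f j * factor f j := by
    funext j
    have := one_sub_mul_factor hf j
    linear_combination this
  rw [h]
  refine PowerSeries.WithPiTopology.multipliable_one_add_of_tendsto_order_atTop_nhds_top ℤ ?_
  rw [ENat.tendsto_nhds_top_iff_natCast_lt]
  intro n
  filter_upwards [Filter.eventually_ge_atTop n] with j hj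
  have h1 : ((j + 1 : ℕ) : ℕ∞) ≤ (atPow f j).order :=
    PowerSeries.nat_le_order _ _ fun i hi => coeff_atPow_eq_zero hf hi
  calc (n : ℕ∞) < ((j + 1 : ℕ) : ℕ∞) := by exact_mod_cast Nat.lt_succ_of_le hj
    _ ≤ (atPow f j).order := h1
    _ ≤ (atPow f j).order + (factor f j).order := le_self_add
    _ ≤ _ := PowerSeries.le_order_mul _ _

end UnitaryMatrixIntegral

end

/-! Expanding the exponential by the multinomial theorem writes the coefficient of `q^l` in the
integrand as a sum over multiplicities `μ` of `∏ (Tr U^k Tr U^{-k})^(μ_k) / (k^(μ_k) μ_k!)` times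
the coefficient of `∏ f(q^k)^(μ_k)`. If the weight `∑ k μ_k` is at most `N`, the moment of the
traces is exactly `∏ k^(μ_k) μ_k!` (`integral_prod_trPow`) and cancels the denominator. Since `∏
f(q^k)^(μ_k)` has order at least `α ∑ k μ_k`, only such `μ` contribute when `l ≤ α N`
(`weight_le_of_coeff_ne_zero`). What remains is the expansion of `∏ 1/(1 - f(q^k))` into geometric
series.

The moment is the trace of an operator. For `σ` with cycle lengths `k` of multiplicity `μ_k`, the
product of the `Tr U^k` is the trace of `U ⊗ ⋯ ⊗ U` times the permutation matrix `P_σ`. Hence the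
moment is the trace of `X ↦ E(P_σ X P_σ⁻¹)`, where `E` averages over conjugation by tensor powers
and projects onto their commutant. With at most `N` tensor factors the `P_τ` span this commutant
(`eq_sum_permMat_of_commute`) and are independent. The operator permutes them by conjugation, so its
trace is the number of `τ` commuting with `σ`, that is `∏ k^(μ_k) μ_k!`. -/

noncomputable section

namespace UnitaryMatrixIntegral

/-! ### Tensor powers of matrices and permutations of the tensor factors -/

section TensorPower

set_option linter.unusedSectionVars false

variable {R κ Ω : Type*} [CommRing R] [Fintype κ] [DecidableEq κ] [Fintype Ω] [DecidableEq Ω]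

/-- The matrix of `M ⊗ ⋯ ⊗ M`, with tensor factors indexed by `Ω`. -/
def tensorPow (Ω : Type*) [Fintype Ω] (M : Matrix κ κ R) : Matrix (Ω → κ) (Ω → κ) R :=
  Matrix.of fun A B => ∏ ω, M (A ω) (B ω)

/-- The matrix that permutes the tensor factors by `τ`. -/
def permMat (R κ : Type*) [CommRing R] [DecidableEq κ] (τ : Equiv.Perm Ω) :
    Matrix (Ω → κ) (Ω → κ) R :=
  Matrix.of fun A B => if A = B ∘ τ then 1 else 0

theorem tensorPow_apply (M : Matrix κ κ R) (A B : Ω → κ) :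
    tensorPow Ω M A B = ∏ ω, M (A ω) (B ω) := rfl

theorem permMat_apply (τ : Equiv.Perm Ω) (A B : Ω → κ) :
    permMat R κ τ A B = if A = B ∘ τ then 1 else 0 := rfl

theorem tensorPow_mul (M M' : Matrix κ κ R) :
    tensorPow Ω (M * M') = tensorPow Ω M * tensorPow Ω M' := by
  ext A B
  simp only [tensorPow_apply, Matrix.mul_apply, Finset.prod_univ_sum, Fintype.piFinset_univ,
    Finset.prod_mul_distrib]

theorem tensorPow_one : tensorPow Ω (1 : Matrix κ κ R) = 1 := by
  ext A B
  simp only [tensorPow_apply, Matrix.one_apply, Finset.prod_ite_zero, Finset.prod_const_one]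
  simp [funext_iff]

theorem tensorPow_diagonal_apply (z : κ → R) (A B : Ω → κ) :
    tensorPow Ω (Matrix.diagonal z) A B = if A = B then ∏ ω, z (A ω) else 0 := by
  simp only [tensorPow_apply, Matrix.diagonal_apply, Finset.prod_ite_zero]
  simp [funext_iff]

theorem tensorPow_diagonal (z : κ → R) :
    tensorPow Ω (Matrix.diagonal z) = Matrix.diagonal fun A => ∏ ω, z (A ω) := by
  ext A B
  simp [tensorPow_diagonal_apply, Matrix.diagonal_apply]

/-- Permutations act by precomposition, so the order of the factors is reversed. -/
theorem permMat_mul (σ τ : Equiv.Perm Ω) :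
    permMat R κ σ * permMat R κ τ = permMat R κ (τ * σ) := by
  ext A B
  simp [Matrix.mul_apply, permMat_apply]
  rfl

theorem commute_permMat_tensorPow (τ : Equiv.Perm Ω) (M : Matrix κ κ R) :
    Commute (permMat R κ τ) (tensorPow Ω M) := by
  ext A B
  have h : ∀ C : Ω → κ, A = C ∘ τ ↔ C = A ∘ ⇑τ⁻¹ := fun C => by
    constructor <;> rintro rfl <;> ext <;> simp
  simp only [Matrix.mul_apply, permMat_apply, h, ite_mul, one_mul, zero_mul, mul_ite, mul_one,
    mul_zero, Finset.sum_ite_eq', Finset.mem_univ, if_true, tensorPow_apply, Function.comp_apply]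
  rw [← Equiv.prod_comp τ]
  simp

theorem trace_tensorPow_mul_permMat (τ : Equiv.Perm Ω) (M : Matrix κ κ R) :
    (tensorPow Ω M * permMat R κ τ).trace = ∑ A : Ω → κ, ∏ ω, M (A ω) (A (τ ω)) := by
  simp [Matrix.trace, Matrix.mul_apply, permMat_apply, tensorPow_apply]

end TensorPower

/-! ### The commutant of the tensor powers of unitary matrices -/

section Commutant

set_option linter.unusedSectionVars false

variable {N : ℕ} {Ω : Type*} [Fintype Ω] [DecidableEq Ω]

theorem diagonal_mem_unitaryGroup {z : Fin N → ℂ} (hz : ∀ a, ‖z a‖ = 1) :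
    Matrix.diagonal z ∈ Matrix.unitaryGroup (Fin N) ℂ := by
  rw [Matrix.mem_unitaryGroup_iff, Matrix.star_eq_conjTranspose, Matrix.diagonal_conjTranspose,
    Matrix.diagonal_mul_diagonal, ← Matrix.diagonal_one]
  congr 1
  ext a
  simp [Complex.mul_conj, Complex.normSq_eq_norm_sq, hz a]

/-- Entries of a matrix commuting with all diagonal unitary tensors preserve weights. -/
theorem card_fiber_eq_of_commute {X : Matrix (Ω → Fin N) (Ω → Fin N) ℂ}
    (hX : ∀ u : U N, Commute X (tensorPow Ω u.1)) {A B : Ω → Fin N} (h : X A B ≠ 0) (a : Fin N) :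
    (Finset.univ.filter fun ω => A ω = a).card = (Finset.univ.filter fun ω => B ω = a).card := by
  -- Fibre sizes lie between `0` and `card Ω`, so a root of unity of order `card Ω + 1` separates
  -- them.
  have hζ := Complex.isPrimitiveRoot_exp (Fintype.card Ω + 1) (by omega)
  set ζ := Complex.exp (2 * Real.pi * Complex.I / ((Fintype.card Ω + 1 : ℕ) : ℂ))
  have hn : ‖ζ‖ = 1 := hζ.norm'_eq_one (by omega)
  have hc := hX ⟨_, diagonal_mem_unitaryGroup (z := fun b => if b = a then ζ else 1)
    (fun b => by split_ifs <;> simp [hn])⟩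
  have hAB := congrFun (congrFun hc.eq A) B
  simp only [tensorPow_diagonal, Matrix.mul_diagonal, Matrix.diagonal_mul, Finset.prod_ite,
    Finset.prod_const, one_pow, mul_one] at hAB
  rw [mul_comm] at hAB
  have hpow := mul_right_cancel₀ h hAB
  exact (hζ.pow_inj (Nat.lt_succ_of_le (Finset.card_le_univ _))
    (Nat.lt_succ_of_le (Finset.card_le_univ _)) hpow).symm

/-- Injectivity of `B` bounds all fibres by one element, which makes `A` injective too, with values
in the range of `B`. -/
theorem exists_perm_of_card_fiber_eq {κ : Type*} [DecidableEq κ] {A B : Ω → κ}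
    (hB : Function.Injective B)
    (h : ∀ a, (Finset.univ.filter fun ω => A ω = a).card =
      (Finset.univ.filter fun ω => B ω = a).card) : ∃ τ : Equiv.Perm Ω, A = B ∘ τ := by
  have h1 : ∀ ω, ∃ ω', A ω = B ω' := fun ω => by
    have : 0 < (Finset.univ.filter fun ω' => B ω' = A ω).card := by
      rw [← h]; exact Finset.card_pos.2 ⟨ω, by simp⟩
    obtain ⟨ω', hω'⟩ := Finset.card_pos.1 this
    exact ⟨ω', by simpa using (Finset.mem_filter.1 hω').2.symm⟩
  choose t ht using h1
  have hA : Function.Injective A := fun x y hxy => by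
    have : (Finset.univ.filter fun ω => A ω = A y).card ≤ 1 := by
      rw [h]
      refine Finset.card_le_one.2 fun p hp q hq => hB ?_
      simp at hp hq
      rw [hp, hq]
    exact Finset.card_le_one.1 this _ (by simp [hxy]) _ (by simp)
  have htinj : Function.Injective t := fun x y hxy => hA (by rw [ht, ht, hxy])
  exact ⟨Equiv.ofBijective t (Finite.injective_iff_bijective.1 htinj), funext ht⟩

/-- The diagonal entry at `A` depends only on the fibre sizes of `A`, which `X` preserves. Here `z`
may have zeros, so singular matrices are covered. -/
theorem commute_tensorPow_diagonal {X : Matrix (Ω → Fin N) (Ω → Fin N) ℂ}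
    (hX : ∀ u : U N, Commute X (tensorPow Ω u.1)) (z : Fin N → ℂ) :
    Commute X (tensorPow Ω (Matrix.diagonal z)) := by
  ext A B
  rw [tensorPow_diagonal, Matrix.mul_diagonal, Matrix.diagonal_mul]
  by_cases h : X A B = 0
  · simp [h]
  · rw [mul_comm]
    congr 1
    rw [← Finset.prod_fiberwise' Finset.univ A z, ← Finset.prod_fiberwise' Finset.univ B z]
    simp only [Finset.prod_const]
    exact Finset.prod_congr rfl fun a _ => by rw [card_fiber_eq_of_commute hX h a]

/-- The matrix of a self-map of the standard basis is a diagonal matrix times a unitary one. -/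
theorem exists_diagonal_mul_unitary (g : Fin N → Fin N) :
    ∃ (z : Fin N → ℂ) (u : U N), (Matrix.of fun a b => if a = g b then (1 : ℂ) else 0) =
      Matrix.diagonal z * u.1 := by
  set c : Fin N → ℕ := fun a => (Finset.univ.filter fun b => a = g b).card
  -- Normalized rows of the matrix of `g`: row `a` contains `c a` ones, and distinct rows have
  -- disjoint supports.
  set v : Fin N → EuclideanSpace ℂ (Fin N) := fun a =>
    WithLp.toLp 2 fun b => if a = g b then ((√(c a : ℝ))⁻¹ : ℂ) else 0
  have hcpos : ∀ a ∈ Set.range g, 0 < c a := by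
    rintro _ ⟨b, rfl⟩
    exact Finset.card_pos.2 ⟨b, by simp⟩
  have hv : Orthonormal ℂ ((Set.range g).domRestrict v) := by
    rw [orthonormal_iff_ite]
    rintro ⟨a, ha⟩ ⟨a', ha'⟩
    simp only [Set.domRestrict_apply, PiLp.inner_apply, v, Subtype.mk.injEq]
    split_ifs with h
    · subst h
      have h0 : (c a : ℝ) ≠ 0 := by exact_mod_cast (hcpos a ha).ne'
      have : ∀ b : Fin N, inner ℂ (if a = g b then ((√(c a : ℝ))⁻¹ : ℂ) else 0)
          (if a = g b then ((√(c a : ℝ))⁻¹ : ℂ) else 0) =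
          if a = g b then (((c a : ℝ)⁻¹ : ℝ) : ℂ) else 0 := fun b => by
        split_ifs
        · rw [← Complex.ofReal_inv, inner_self_eq_norm_sq_to_K, Complex.norm_real]
          simp [Real.sq_sqrt, abs_of_nonneg, inv_pow, ← Complex.ofReal_pow]
        · simp
      simp only [this, Finset.sum_ite, Finset.sum_const, nsmul_eq_mul,
        mul_zero, add_zero]
      change (c a : ℂ) * _ = 1
      rw [← Complex.ofReal_natCast, ← Complex.ofReal_mul, mul_inv_cancel₀ h0, Complex.ofReal_one]
    · refine Finset.sum_eq_zero fun b _ => ?_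
      split_ifs with h1 h2
      · exact absurd (h1.trans h2.symm) h
      all_goals simp
  -- The rows outside the range of `g` are arbitrary, since the diagonal factor `√(c a)` vanishes
  -- there.
  obtain ⟨b, hb⟩ := hv.exists_orthonormalBasis_extension_of_card_eq (by simp)
  have hu : (Matrix.of fun i j => b i j) ∈ Matrix.unitaryGroup (Fin N) ℂ := by
    rw [Matrix.mem_unitaryGroup_iff]
    ext i j
    have := orthonormal_iff_ite.1 b.orthonormal j i
    simp only [PiLp.inner_apply, RCLike.inner_apply] at this
    simp [Matrix.mul_apply, Matrix.star_apply, Matrix.one_apply, this, eq_comm]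
  refine ⟨fun a => (√(c a : ℝ) : ℂ), ⟨_, hu⟩, ?_⟩
  ext i j
  rw [Matrix.diagonal_mul]
  simp only [Matrix.of_apply]
  by_cases hi : i ∈ Set.range g
  · have h0 : (√(c i : ℝ) : ℂ) ≠ 0 := by
      have := Real.sqrt_pos.2 (show (0 : ℝ) < c i by exact_mod_cast hcpos i hi)
      exact_mod_cast this.ne'
    rw [hb i hi]
    simp only [v]
    split_ifs <;> simp [h0]
  · have h0 : c i = 0 := by
      simp only [c, Finset.card_eq_zero, Finset.filter_eq_empty_iff]
      rintro b - rfl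
      exact hi ⟨b, rfl⟩
    rw [if_neg (fun h => hi ⟨j, h.symm⟩), h0]
    simp

/-- A matrix commuting with all `U ⊗ ⋯ ⊗ U` is a combination of permutations of the factors, when
there are at most `N` factors. -/
theorem eq_sum_permMat_of_commute {X : Matrix (Ω → Fin N) (Ω → Fin N) ℂ}
    (hX : ∀ u : U N, Commute X (tensorPow Ω u.1)) {e : Ω → Fin N} (he : Function.Injective e) :
    X = ∑ τ : Equiv.Perm Ω, X (e ∘ τ) e • permMat ℂ (Fin N) τ := by
  ext A B
  -- The self-map `g = Function.extend e B id` satisfies `g ∘ e = B`; commuting with its tensor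
  -- power reduces column `B` of `X` to column `e`.
  obtain ⟨z, u, hzu⟩ := exists_diagonal_mul_unitary (Function.extend e B id)
  have hc : Commute X (tensorPow Ω (Matrix.of fun a b =>
      if a = Function.extend e B id b then (1 : ℂ) else 0)) := by
    rw [hzu, tensorPow_mul]
    exact (commute_tensorPow_diagonal hX z).mul_right (hX u)
  have hT : ∀ C D : Ω → Fin N, tensorPow Ω (Matrix.of fun a b =>
      if a = Function.extend e B id b then (1 : ℂ) else 0) C D =
        if C = Function.extend e B id ∘ D then 1 else 0 := fun C D => by
    simp only [tensorPow_apply, Matrix.of_apply, Finset.prod_ite_zero, Finset.prod_const_one]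
    simp [funext_iff]
  -- At the entry `(A, e)`, one side is `X A B` and the other is the sum of `X C e` over all `C`
  -- with `A = g ∘ C`.
  have hAe := congrFun (congrFun hc.eq A) e
  simp only [Matrix.mul_apply, hT, Function.extend_comp he, mul_ite, mul_one, mul_zero,
    Finset.sum_ite_eq', Finset.mem_univ, if_true, ite_mul, one_mul, zero_mul] at hAe
  rw [hAe, Matrix.sum_apply]
  have hinj : Function.Injective fun τ : Equiv.Perm Ω => e ∘ τ := fun σ τ h => by
    ext ω
    exact he (congrFun h ω)
  rw [← Finset.sum_subset (Finset.subset_univ (Finset.univ.image fun τ : Equiv.Perm Ω => e ∘ τ)),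
    Finset.sum_image hinj.injOn]
  · refine Finset.sum_congr rfl fun τ _ => ?_
    rw [← Function.comp_assoc, Function.extend_comp he]
    simp [permMat_apply]
  -- By preservation of fibre sizes, column `e` of `X` is supported on the rearrangements `e ∘ τ`.
  · intro C _ hC
    by_cases h : X C e = 0
    · simp [h]
    · obtain ⟨τ, rfl⟩ := exists_perm_of_card_fiber_eq he (card_fiber_eq_of_commute hX h)
      simp at hC

end Commutant

/-! ### Averaging over the unitary group -/

section Average

open MeasureTheory

set_option linter.unusedSectionVars false

variable {N : ℕ} {Ω : Type*} [Fintype Ω] [DecidableEq Ω]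

theorem integrable_of_continuous {g : U N → ℂ} (hg : Continuous g) : Integrable g (haarU N) :=
  hg.integrable_of_hasCompactSupport (HasCompactSupport.of_compactSpace _)

theorem continuous_tensorPow : Continuous fun u : U N => tensorPow Ω u.1 :=
  continuous_matrix fun A B => continuous_finsetProd _ fun ω _ =>
    continuous_subtype_val.matrix_elem (A ω) (B ω)

/-- Conjugation of `X` by the tensor power of a unitary matrix. -/
def tensorConj (u : U N) (X : Matrix (Ω → Fin N) (Ω → Fin N) ℂ) :
    Matrix (Ω → Fin N) (Ω → Fin N) ℂ :=
  tensorPow Ω u.1 * X * tensorPow Ω (u⁻¹ : U N).1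

theorem continuous_tensorConj (X : Matrix (Ω → Fin N) (Ω → Fin N) ℂ) :
    Continuous fun u : U N => tensorConj u X :=
  (continuous_tensorPow.matrix_mul continuous_const).matrix_mul
    (continuous_tensorPow.comp continuous_inv)

theorem integrable_tensorConj (X : Matrix (Ω → Fin N) (Ω → Fin N) ℂ) (A B : Ω → Fin N) :
    Integrable (fun u : U N => tensorConj u X A B) (haarU N) :=
  integrable_of_continuous ((continuous_tensorConj X).matrix_elem A B)

theorem tensorPow_mul_inv (u : U N) : tensorPow Ω u.1 * tensorPow Ω (u⁻¹ : U N).1 = 1 := by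
  rw [← tensorPow_mul, ← Submonoid.coe_mul, mul_inv_cancel, Submonoid.coe_one, tensorPow_one]

theorem tensorPow_inv_mul (u : U N) : tensorPow Ω (u⁻¹ : U N).1 * tensorPow Ω u.1 = 1 := by
  rw [← tensorPow_mul, ← Submonoid.coe_mul, inv_mul_cancel, Submonoid.coe_one, tensorPow_one]

theorem tensorConj_tensorConj (u v : U N) (X : Matrix (Ω → Fin N) (Ω → Fin N) ℂ) :
    tensorConj u (tensorConj v X) = tensorConj (u * v) X := by
  simp only [tensorConj, mul_inv_rev, Submonoid.coe_mul, tensorPow_mul, mul_assoc]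

theorem tensorConj_of_commute {u : U N} {X : Matrix (Ω → Fin N) (Ω → Fin N) ℂ}
    (h : Commute X (tensorPow Ω u.1)) : tensorConj u X = X := by
  rw [tensorConj, ← h.eq, mul_assoc, tensorPow_mul_inv, mul_one]

theorem commute_of_tensorConj {u : U N} {X : Matrix (Ω → Fin N) (Ω → Fin N) ℂ}
    (h : tensorConj u X = X) : Commute X (tensorPow Ω u.1) := by
  have : tensorConj u X * tensorPow Ω u.1 = tensorPow Ω u.1 * X := by
    rw [tensorConj, mul_assoc, tensorPow_inv_mul, mul_one]
  rwa [h] at this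

/-- The average of the conjugates of `X` by the tensor powers of unitary matrices. -/
def average (N : ℕ) (Ω : Type*) [Fintype Ω] [DecidableEq Ω] :
    Matrix (Ω → Fin N) (Ω → Fin N) ℂ →ₗ[ℂ] Matrix (Ω → Fin N) (Ω → Fin N) ℂ where
  toFun X := Matrix.of fun A B => ∫ u, tensorConj u X A B ∂haarU N
  map_add' X Y := by
    ext A B
    simp only [Matrix.of_apply, Matrix.add_apply]
    rw [← integral_add (integrable_tensorConj X A B) (integrable_tensorConj Y A B)]
    simp only [tensorConj, mul_add, add_mul, Matrix.add_apply]
  map_smul' c X := by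
    ext A B
    simp only [Matrix.of_apply, Matrix.smul_apply, RingHom.id_apply, smul_eq_mul]
    rw [← integral_const_mul]
    simp only [tensorConj, Matrix.mul_smul, Matrix.smul_mul, Matrix.smul_apply, smul_eq_mul]

theorem average_apply (X : Matrix (Ω → Fin N) (Ω → Fin N) ℂ) (A B : Ω → Fin N) :
    average N Ω X A B = ∫ u, tensorConj u X A B ∂haarU N := rfl

/-- Left invariance of the Haar measure, applied entrywise to `u ↦ v * u`. -/
theorem tensorConj_average (v : U N) (X : Matrix (Ω → Fin N) (Ω → Fin N) ℂ) :
    tensorConj v (average N Ω X) = average N Ω X := by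
  ext A B
  have h : ∀ u : U N, tensorConj (v * u) X A B = ∑ D, (∑ C, tensorPow Ω v.1 A C *
      tensorConj u X C D) * tensorPow Ω (v⁻¹ : U N).1 D B := fun u => by
    rw [← tensorConj_tensorConj, tensorConj, Matrix.mul_apply]
    simp only [Matrix.mul_apply (M := tensorPow Ω v.1)]
  rw [average_apply, ← integral_mul_left_eq_self (fun u => tensorConj u X A B) v]
  simp only [h]
  rw [integral_finsetSum]
  · simp only [tensorConj, Matrix.mul_apply (N := tensorPow Ω (v⁻¹ : U N).1),
      Matrix.mul_apply (M := tensorPow Ω v.1)]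
    refine Finset.sum_congr rfl fun D _ => ?_
    rw [integral_mul_const, integral_finsetSum]
    · simp only [integral_const_mul]
      rfl
    · exact fun C _ => (integrable_tensorConj X C D).const_mul _
  · exact fun D _ => (integrable_finsetSum _ fun C _ =>
      (integrable_tensorConj X C D).const_mul _).mul_const _

theorem commute_average (X : Matrix (Ω → Fin N) (Ω → Fin N) ℂ) (u : U N) :
    Commute (average N Ω X) (tensorPow Ω u.1) :=
  commute_of_tensorConj (tensorConj_average u X)

theorem average_of_commute {X : Matrix (Ω → Fin N) (Ω → Fin N) ℂ}
    (h : ∀ u : U N, Commute X (tensorPow Ω u.1)) : average N Ω X = X := by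
  ext A B
  simp [average_apply, tensorConj_of_commute (h _)]

/-- The trace of `X ↦ ∫ T(U) R X R' T(U)⁻¹ dU`, where `R`, `R'` permute the tensor factors. -/
theorem sum_average_single (σ σ' : Equiv.Perm Ω) :
    ∑ A : Ω → Fin N, ∑ B : Ω → Fin N,
      average N Ω (permMat ℂ (Fin N) σ * Matrix.single A B 1 * permMat ℂ (Fin N) σ') A B =
    ∫ u : U N, (tensorPow Ω u.1 * permMat ℂ (Fin N) σ).trace *
      (tensorPow Ω (u⁻¹ : U N).1 * permMat ℂ (Fin N) σ').trace ∂haarU N := by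
  have h : ∀ (u : U N) (A B : Ω → Fin N),
      tensorConj u (permMat ℂ (Fin N) σ * Matrix.single A B 1 * permMat ℂ (Fin N) σ') A B =
        (tensorPow Ω u.1 * permMat ℂ (Fin N) σ) A A * (tensorPow Ω (u⁻¹ : U N).1 * permMat ℂ (Fin N) σ') B B :=
    fun u A B => by
      have hc := commute_permMat_tensorPow (R := ℂ) σ' (u⁻¹ : U N).1
      rw [tensorConj, ← hc.eq]
      simp only [← mul_assoc]
      rw [mul_assoc _ (permMat ℂ (Fin N) σ'), mul_assoc _ (Matrix.single A B 1), Matrix.mul_apply,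
        Finset.sum_eq_single A]
      · simp
      · intro C _ hC
        rw [Matrix.single_mul_apply_of_ne _ _ _ _ _ hC, mul_zero]
      · simp
  simp only [average_apply]
  simp only [Matrix.trace, Matrix.diag_apply, Finset.sum_mul_sum, ← h]
  rw [integral_finsetSum]
  · refine Finset.sum_congr rfl fun A _ => ?_
    rw [integral_finsetSum]
    exact fun B _ => integrable_tensorConj _ _ _
  · exact fun A _ => integrable_finsetSum _ fun B _ => integrable_tensorConj _ _ _

theorem sum_mul_map_single {κ : Type*} [Fintype κ] [DecidableEq κ]
    (L : Matrix κ κ ℂ →ₗ[ℂ] Matrix κ κ ℂ) (X : Matrix κ κ ℂ) (C D : κ) :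
    ∑ A, ∑ B, X A B * L (Matrix.single A B 1) C D = L X C D := by
  conv_rhs => rw [Matrix.matrix_eq_sum_single X]
  simp only [map_sum, Matrix.sum_apply]
  refine Finset.sum_congr rfl fun A _ => Finset.sum_congr rfl fun B _ => ?_
  rw [show Matrix.single A B (X A B) = X A B • Matrix.single A B (1 : ℂ) by simp, map_smul,
    Matrix.smul_apply, smul_eq_mul]

/-- The trace of a linear map whose values lie in the commutant of the unitary tensors. -/
theorem sum_map_single_eq_sum_perm
    (L : Matrix (Ω → Fin N) (Ω → Fin N) ℂ →ₗ[ℂ] Matrix (Ω → Fin N) (Ω → Fin N) ℂ)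
    (hL : ∀ X, ∀ u : U N, Commute (L X) (tensorPow Ω u.1)) {e : Ω → Fin N}
    (he : Function.Injective e) :
    ∑ A, ∑ B, L (Matrix.single A B 1) A B =
      ∑ τ : Equiv.Perm Ω, L (permMat ℂ (Fin N) τ) (e ∘ τ) e := by
  -- On the commutant, `Y ↦ Y (e ∘ τ) e` is the coordinate of `Y` along `permMat τ`; the trace of
  -- `L` is then read off in these coordinates.
  have hLX : ∀ X A B, L X A B =
      ∑ τ : Equiv.Perm Ω, permMat ℂ (Fin N) τ A B * L X (e ∘ τ) e := fun X A B => by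
    conv_lhs => rw [eq_sum_permMat_of_commute (hL X) he]
    simp only [Matrix.sum_apply, Matrix.smul_apply, smul_eq_mul, mul_comm]
  simp only [← sum_mul_map_single L (permMat ℂ (Fin N) _)]
  rw [Finset.sum_comm (γ := Equiv.Perm Ω)]
  refine Finset.sum_congr rfl fun A _ => ?_
  rw [Finset.sum_comm (γ := Equiv.Perm Ω)]
  exact Finset.sum_congr rfl fun B _ => hLX _ A B

/-- Orthogonality relation for products of power sums of unitary matrices. -/
theorem integral_trace_mul_trace (σ : Equiv.Perm Ω) (hN : Fintype.card Ω ≤ N) :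
    ∫ u : U N, (tensorPow Ω u.1 * permMat ℂ (Fin N) σ).trace *
      (tensorPow Ω (u⁻¹ : U N).1 * permMat ℂ (Fin N) σ⁻¹).trace ∂haarU N =
    (Nat.card (Subgroup.centralizer ({σ} : Set (Equiv.Perm Ω))) : ℂ) := by
  obtain ⟨e⟩ : Nonempty (Ω ↪ Fin N) := Function.Embedding.nonempty_of_card_le (by simpa using hN)
  rw [← sum_average_single]
  refine (sum_map_single_eq_sum_perm (average N Ω ∘ₗ
    LinearMap.mulRight ℂ (permMat ℂ (Fin N) σ⁻¹) ∘ₗ LinearMap.mulLeft ℂ (permMat ℂ (Fin N) σ))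
    (fun X u => commute_average (permMat ℂ (Fin N) σ * X * permMat ℂ (Fin N) σ⁻¹) u)
    e.injective).trans ?_
  have h : ∀ τ : Equiv.Perm Ω, average N Ω (permMat ℂ (Fin N) σ * permMat ℂ (Fin N) τ *
      permMat ℂ (Fin N) σ⁻¹) = permMat ℂ (Fin N) (σ⁻¹ * τ * σ) := fun τ => by
    rw [permMat_mul, permMat_mul,
      average_of_commute fun u => commute_permMat_tensorPow (σ⁻¹ * (τ * σ)) u.1, mul_assoc]
  -- The diagonal coefficient at `τ` is `1` exactly when conjugation by `σ` fixes `τ`.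
  have hfix : ∀ τ : Equiv.Perm Ω, e ∘ τ = e ∘ ⇑(σ⁻¹ * τ * σ) ↔
      τ ∈ Subgroup.centralizer ({σ} : Set (Equiv.Perm Ω)) := fun τ => by
    rw [Subgroup.mem_centralizer_singleton_iff, e.injective.comp_left.eq_iff,
      DFunLike.coe_fn_eq, mul_assoc, eq_inv_mul_iff_mul_eq, eq_comm]
  simp only [LinearMap.comp_apply, LinearMap.mulRight_apply, LinearMap.mulLeft_apply, h,
    permMat_apply, Finset.sum_boole]
  rw [Nat.subtype_card (Finset.univ.filter fun τ : Equiv.Perm Ω => e ∘ τ = e ∘ ⇑(σ⁻¹ * τ * σ))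
    fun τ => by simp only [Finset.mem_filter, Finset.mem_univ, true_and, hfix]]

end Average

/-! ### Power sums as traces against permutations -/

section CycleTrace

set_option linter.unusedSectionVars false

variable {R κ : Type*} [CommRing R] [Fintype κ] [DecidableEq κ]

/-- Matrix powers as sums over paths with `n` steps. The arbitrary weight `g` on the endpoints lets
the induction absorb the first step and later closes the path to a cycle. -/
theorem sum_prod_path (M : Matrix κ κ R) (n : ℕ) (g : κ → κ → R) :
    ∑ A : Fin (n + 1) → κ, (∏ i : Fin n, M (A i.castSucc) (A i.succ)) * g (A 0) (A (Fin.last n)) =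
      ∑ a, ∑ b, (M ^ n) a b * g a b := by
  induction n generalizing g with
  | zero =>
    rw [← (Equiv.funUnique (Fin 1) κ).symm.sum_comp]
    simp [Matrix.one_apply]
  | succ n ih =>
    rw [← (Fin.consEquiv fun _ => κ).sum_comp, Fintype.sum_prod_type, Finset.sum_comm]
    have h := ih fun a' b => ∑ a, M a a' * g a b
    calc _ = ∑ A : Fin (n + 1) → κ, (∏ i : Fin n, M (A i.castSucc) (A i.succ)) *
          ∑ a, M a (A 0) * g a (A (Fin.last n)) := by
          refine Finset.sum_congr rfl fun A _ => ?_
          rw [Finset.mul_sum]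
          refine Finset.sum_congr rfl fun a _ => ?_
          simp only [Fin.consEquiv_apply, Fin.prod_univ_succ (n := n), Fin.castSucc_zero,
            Fin.cons_zero, Fin.cons_succ, ← Fin.succ_last, ← Fin.succ_castSucc]
          ring
      _ = _ := by
          rw [h]
          simp only [pow_succ', Matrix.mul_apply, Finset.mul_sum, Finset.sum_mul]
          rw [Finset.sum_comm]
          conv_rhs => rw [Finset.sum_comm]
          refine Finset.sum_congr rfl fun b _ => ?_
          rw [Finset.sum_comm]
          refine Finset.sum_congr rfl fun a _ => Finset.sum_congr rfl fun c _ => ?_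
          ring

theorem sum_prod_finRotate (M : Matrix κ κ R) {k : ℕ} (hk : 0 < k) :
    ∑ A : Fin k → κ, ∏ i, M (A i) (A (finRotate k i)) = (M ^ k).trace := by
  obtain ⟨n, rfl⟩ := Nat.exists_eq_succ_of_ne_zero hk.ne'
  -- The weight is the closing step from the last vertex back to the first.
  have h := sum_prod_path M n fun a b => M b a
  rw [pow_succ, Matrix.trace]
  simp only [Matrix.diag_apply, Matrix.mul_apply]
  rw [← h]
  refine Finset.sum_congr rfl fun A _ => ?_
  rw [Fin.prod_univ_castSucc]
  simp

theorem sum_prod_sumCongr {α β : Type*} [Fintype α] [Fintype β] [DecidableEq α] [DecidableEq β]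
    (M : Matrix κ κ R) (σ : Equiv.Perm α) (τ : Equiv.Perm β) :
    ∑ A : α ⊕ β → κ, ∏ i, M (A i) (A (Equiv.Perm.sumCongr σ τ i)) =
      (∑ A : α → κ, ∏ i, M (A i) (A (σ i))) * ∑ A : β → κ, ∏ i, M (A i) (A (τ i)) := by
  rw [← (Equiv.sumArrowEquivProdArrow α β κ).symm.sum_comp, Fintype.sum_prod_type,
    Finset.sum_mul_sum]
  simp [Fintype.prod_sum_type, Equiv.sumArrowEquivProdArrow]

/-- The two permutations, each extended by the identity, are disjoint, and cycle types add over
disjoint products. -/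
theorem cycleType_sumCongr {α β : Type*} [Fintype α] [Fintype β] [DecidableEq α] [DecidableEq β]
    (σ : Equiv.Perm α) (τ : Equiv.Perm β) :
    (Equiv.Perm.sumCongr σ τ).cycleType = σ.cycleType + τ.cycleType := by
  classical
  have h1 : Equiv.Perm.sumCongr σ (1 : Equiv.Perm β) =
      σ.extendDomain (Equiv.ofInjective (Sum.inl : α → α ⊕ β) Sum.inl_injective) := by
    ext x
    rcases x with x | x
    · exact (Equiv.Perm.extendDomain_apply_image σ
        (Equiv.ofInjective (Sum.inl : α → α ⊕ β) Sum.inl_injective) x).symm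
    · rw [Equiv.Perm.extendDomain_apply_not_subtype _ _ (by simp)]
      rfl
  have h2 : Equiv.Perm.sumCongr (1 : Equiv.Perm α) τ =
      τ.extendDomain (Equiv.ofInjective (Sum.inr : β → α ⊕ β) Sum.inr_injective) := by
    ext x
    rcases x with x | x
    · rw [Equiv.Perm.extendDomain_apply_not_subtype _ _ (by simp)]
      rfl
    · exact (Equiv.Perm.extendDomain_apply_image τ
        (Equiv.ofInjective (Sum.inr : β → α ⊕ β) Sum.inr_injective) x).symm
  have hd : Equiv.Perm.Disjoint (Equiv.Perm.sumCongr σ (1 : Equiv.Perm β))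
      (Equiv.Perm.sumCongr (1 : Equiv.Perm α) τ) := by
    rintro (x | x)
    · exact Or.inr rfl
    · exact Or.inl rfl
  have hm : Equiv.Perm.sumCongr σ τ = Equiv.Perm.sumCongr σ (1 : Equiv.Perm β) *
      Equiv.Perm.sumCongr (1 : Equiv.Perm α) τ := by
    rw [Equiv.Perm.sumCongr_mul, mul_one, one_mul]
  rw [hm, hd.cycleType_mul, h1, h2, Equiv.Perm.cycleType_extendDomain,
    Equiv.Perm.cycleType_extendDomain]

/-- `cycleType` omits fixed points, hence the filter: for `k = 1` both sides are empty. -/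
theorem cycleType_finRotate_eq_filter {k : ℕ} (hk : 0 < k) :
    (finRotate k).cycleType = ({k} : Multiset ℕ).filter (2 ≤ ·) := by
  rcases Nat.lt_or_ge k 2 with h | h
  · obtain rfl : k = 1 := by omega
    rw [finRotate_one, Multiset.filter_singleton, if_neg (by omega)]
    exact Equiv.Perm.cycleType_one
  · rw [cycleType_finRotate_of_le h, Multiset.filter_singleton, if_pos h]

/-- A product of power sums is the trace of a tensor power against a permutation. -/
theorem exists_perm_sum_prod_eq (s : Multiset ℕ) (hs : ∀ k ∈ s, 0 < k) :
    ∃ (Ω : Type) (_ : Fintype Ω) (_ : DecidableEq Ω) (σ : Equiv.Perm Ω),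
      Fintype.card Ω = s.sum ∧ σ.cycleType = s.filter (2 ≤ ·) ∧
      ∀ M : Matrix κ κ R, ∑ A : Ω → κ, ∏ ω, M (A ω) (A (σ ω)) =
        (s.map fun k => (M ^ k).trace).prod := by
  induction s using Multiset.induction with
  | empty => exact ⟨Empty, inferInstance, inferInstance, 1, by simp⟩
  | cons k s ih =>
    obtain ⟨Ω, _, _, σ, hcard, hcyc, hM⟩ := ih fun j hj => hs j (Multiset.mem_cons_of_mem hj)
    have hk := hs k (Multiset.mem_cons_self k s)
    refine ⟨Fin k ⊕ Ω, inferInstance, inferInstance, Equiv.Perm.sumCongr (finRotate k) σ, ?_, ?_,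
      fun M => ?_⟩
    · simp [hcard]
    · rw [cycleType_sumCongr, hcyc, cycleType_finRotate_eq_filter hk, ← Multiset.filter_add,
        Multiset.singleton_add]
    · rw [sum_prod_sumCongr, hM, sum_prod_finRotate M hk, Multiset.map_cons, Multiset.prod_cons]

/-- Trades `σ⁻¹` for a transpose, which does not change traces of powers, so one `σ` serves both
trace factors of the moment. -/
theorem sum_prod_inv {Ω : Type*} [Fintype Ω] [DecidableEq Ω] (M : Matrix κ κ R)
    (σ : Equiv.Perm Ω) :
    ∑ A : Ω → κ, ∏ ω, M (A ω) (A (σ⁻¹ ω)) = ∑ A : Ω → κ, ∏ ω, M.transpose (A ω) (A (σ ω)) := by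
  refine Finset.sum_congr rfl fun A _ => ?_
  rw [← Equiv.prod_comp σ]
  simp [Matrix.transpose_apply]

/-- The general formula treats fixed points apart from `cycleType`; here their factor `(s.count 1)!`
is merged back into the product. -/
theorem nat_card_centralizer_eq {Ω : Type*} [Fintype Ω] [DecidableEq Ω] (σ : Equiv.Perm Ω)
    {s : Multiset ℕ} (hs : ∀ k ∈ s, 0 < k) (hcard : Fintype.card Ω = s.sum)
    (hσ : σ.cycleType = s.filter (2 ≤ ·)) :
    Nat.card (Subgroup.centralizer ({σ} : Set (Equiv.Perm Ω))) =
      s.prod * ∏ k ∈ s.toFinset, (s.count k).factorial := by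
  have h1 : s.filter (fun k => ¬ 2 ≤ k) = Multiset.replicate (s.count 1) 1 := by
    rw [← Multiset.filter_eq' s 1]
    refine Multiset.filter_congr fun k hk => ?_
    have := hs k hk
    omega
  have hsplit := Multiset.filter_add_not (fun k => 2 ≤ k) s
  have hsum : s.sum = (s.filter (2 ≤ ·)).sum + s.count 1 := by
    conv_lhs => rw [← hsplit, h1]
    simp
  have hprod : s.prod = (s.filter (2 ≤ ·)).prod := by
    conv_lhs => rw [← hsplit, h1]
    simp
  rw [Equiv.Perm.nat_card_centralizer, hσ, hcard, hsum, Nat.add_sub_cancel_left, hprod]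
  have hfac : ∏ k ∈ s.toFinset, (s.count k).factorial = (s.count 1).factorial *
      ∏ k ∈ (s.filter (2 ≤ ·)).toFinset, ((s.filter (2 ≤ ·)).count k).factorial := by
    have h2 : (s.filter (2 ≤ ·)).toFinset = s.toFinset.erase 1 := by
      ext k
      simp only [Multiset.mem_toFinset, Multiset.mem_filter, Finset.mem_erase]
      constructor
      · rintro ⟨h, h'⟩; exact ⟨by omega, h⟩
      · rintro ⟨h, h'⟩; exact ⟨h', by have := hs k h'; omega⟩
    have h3 : ∏ k ∈ s.toFinset.erase 1, ((s.filter (2 ≤ ·)).count k).factorial =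
        ∏ k ∈ s.toFinset.erase 1, (s.count k).factorial := by
      refine Finset.prod_congr rfl fun k hk => ?_
      rw [← h2] at hk
      rw [Multiset.count_filter_of_pos (Multiset.mem_filter.1 (Multiset.mem_toFinset.1 hk)).2]
    rw [h2, h3]
    by_cases h : 1 ∈ s.toFinset
    · exact (Finset.mul_prod_erase _ (fun k => (s.count k).factorial) h).symm
    · rw [Finset.erase_eq_of_notMem h, Multiset.count_eq_zero.2 (by simpa using h)]
      simp
  rw [hfac]
  ring

end CycleTrace

/-! ### Moments of traces of powers in the stable range. -/

section PowerSumMoments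

open MeasureTheory

variable {N : ℕ}

theorem trPow_natCast (u : U N) (k : ℕ) : trPow u k = (u.1 ^ k).trace := by
  simp [trPow]

theorem trPow_neg_natCast (u : U N) (k : ℕ) : trPow u (-k) = ((u⁻¹ : U N).1 ^ k).trace := by
  rw [trPow, zpow_neg, ← inv_zpow, zpow_natCast, SubmonoidClass.coe_pow]

theorem integral_prod_trPow_multiset (s : Multiset ℕ) (hs : ∀ k ∈ s, 0 < k) (hN : s.sum ≤ N) :
    ∫ u : U N, (s.map fun k : ℕ => trPow u k * trPow u (-k)).prod ∂haarU N =
      ((s.prod * ∏ k ∈ s.toFinset, (s.count k).factorial : ℕ) : ℂ) := by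
  obtain ⟨Ω, _, _, σ, hcard, hcyc, hM⟩ := exists_perm_sum_prod_eq (R := ℂ) (κ := Fin N) s hs
  rw [← nat_card_centralizer_eq σ hs hcard hcyc, ← integral_trace_mul_trace σ (hcard.trans_le hN)]
  congr 1
  ext u
  rw [Multiset.prod_map_mul, trace_tensorPow_mul_permMat, trace_tensorPow_mul_permMat,
    sum_prod_inv, hM, hM]
  simp only [trPow_natCast, trPow_neg_natCast, ← Matrix.transpose_pow, Matrix.trace_transpose]

/-- Moments of the power sums on `U(N)` in the stable range are those of independent complex
Gaussians. -/
theorem integral_prod_trPow {K : ℕ} (μ : Fin K → ℕ) (hN : ∑ j : Fin K, ((j : ℕ) + 1) * μ j ≤ N) :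
    ∫ u : U N, ∏ j : Fin K,
      (trPow u (((j : ℕ) + 1 : ℕ) : ℤ) * trPow u (-(((j : ℕ) + 1 : ℕ) : ℤ))) ^ μ j ∂haarU N =
      ∏ j : Fin K, ((((j : ℕ) + 1 : ℕ) : ℂ) ^ μ j * ((μ j).factorial : ℂ)) := by
  -- The cycle lengths: `μ j` cycles of length `j + 1`.
  set s : Multiset ℕ := ∑ j : Fin K, Multiset.replicate (μ j) ((j : ℕ) + 1) with hs
  have hmem : ∀ k ∈ s, 0 < k := fun k hk => by
    obtain ⟨j, -, hj⟩ := Multiset.mem_sum.1 hk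
    rw [Multiset.eq_of_mem_replicate hj]
    omega
  have hsum : s.sum = ∑ j : Fin K, ((j : ℕ) + 1) * μ j := by
    simp [hs, Multiset.sum_sum, mul_comm]
  have hprod : s.prod = ∏ j : Fin K, ((j : ℕ) + 1) ^ μ j := by
    simp [hs, Multiset.prod_sum]
  have hcount : ∀ j : Fin K, s.count ((j : ℕ) + 1) = μ j := fun j => by
    rw [hs, Multiset.count_sum', Finset.sum_eq_single j]
    · simp
    · intro i _ hij
      simp [Multiset.count_replicate, Fin.val_inj, hij]
    · simp
  have hfac : ∏ k ∈ s.toFinset, (s.count k).factorial =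
      ∏ j : Fin K, (μ j).factorial := by
    rw [Finset.prod_subset (s₂ := Finset.univ.image fun j : Fin K => (j : ℕ) + 1)]
    · rw [Finset.prod_image fun i _ j _ hij => Fin.ext (by simpa using hij)]
      exact Finset.prod_congr rfl fun j _ => by rw [hcount j]
    · intro k hk
      obtain ⟨j, hjK, hj⟩ := Multiset.mem_sum.1 (Multiset.mem_toFinset.1 hk)
      exact Finset.mem_image.2 ⟨j, hjK, (Multiset.eq_of_mem_replicate hj).symm⟩
    · intro k _ hk
      rw [Multiset.count_eq_zero.2 (by simpa using hk), Nat.factorial_zero]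
  have hmap : ∀ g : ℕ → ℂ, (s.map g).prod = ∏ j : Fin K, g ((j : ℕ) + 1) ^ μ j := fun g => by
    rw [hs, ← Multiset.coe_mapAddMonoidHom, map_sum, Multiset.prod_sum]
    simp
  have h := integral_prod_trPow_multiset (N := N) s hmem (hsum.trans_le hN)
  rw [hprod, hfac, ← Finset.prod_mul_distrib] at h
  simp only [hmap] at h
  rw [h]
  push_cast
  rfl

end PowerSumMoments

/-! ### Power series modulo a power of the variable -/

section Truncation

variable {R : Type*} [CommRing R]

/-- Reduction of power series modulo `X ^ n`. -/
abbrev modXPow (R : Type*) [CommRing R] (n : ℕ) :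
    R⟦X⟧ →+* R⟦X⟧ ⧸ Ideal.span {(PowerSeries.X : R⟦X⟧) ^ n} :=
  Ideal.Quotient.mk _

theorem modXPow_eq_iff {n : ℕ} {a b : R⟦X⟧} :
    modXPow R n a = modXPow R n b ↔ ∀ m < n, PowerSeries.coeff m a = PowerSeries.coeff m b := by
  rw [Ideal.Quotient.eq, Ideal.mem_span_singleton, PowerSeries.X_pow_dvd_iff]
  simp [sub_eq_zero]

/-- Reconciles two index sets: the exponential groups `μ` by total degree, while the product of
truncated geometric series runs over a box. -/
theorem sum_range_sum_piAntidiag {M : Type*} [AddCommMonoid M] {K l : ℕ} (h : (Fin K → ℕ) → M)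
    (h0 : ∀ μ, l < ∑ j, μ j → h μ = 0) :
    ∑ m ∈ Finset.range (l + 1), ∑ μ ∈ (Finset.univ : Finset (Fin K)).piAntidiag m, h μ =
      ∑ μ ∈ Fintype.piFinset fun _ : Fin K => Finset.range (l + 1), h μ := by
  rw [← Finset.sum_filter_of_ne (p := fun μ : Fin K → ℕ => ∑ j, μ j ∈ Finset.range (l + 1))]
  · rw [← Finset.sum_fiberwise_of_maps_to (t := Finset.range (l + 1))
      (g := fun μ : Fin K → ℕ => ∑ j, μ j) fun μ hμ => (Finset.mem_filter.1 hμ).2]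
    refine Finset.sum_congr rfl fun m hm => Finset.sum_congr ?_ fun _ _ => rfl
    ext μ
    simp only [Finset.mem_piAntidiag, Finset.mem_univ, implies_true, and_true, Finset.mem_filter,
      Fintype.mem_piFinset, Finset.mem_range] at hm ⊢
    refine ⟨fun h => ?_, fun h => h.2⟩
    change ∑ j, μ j = m at h
    refine ⟨⟨fun j => ?_, h ▸ hm⟩, h⟩
    have := Finset.single_le_sum (f := μ) (fun i _ => Nat.zero_le _) (Finset.mem_univ j)
    omega
  · intro μ _ hμ
    by_contra hlt
    rw [Finset.mem_range] at hlt
    exact hμ (h0 μ (by omega))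

end Truncation

/-! ### Both coefficients as sums over multiplicities. -/

section Expansion

variable {f : ℤ⟦X⟧}

theorem modXPow_factor_of_le (hf : PowerSeries.constantCoeff f = 0) {l j : ℕ} (h : l ≤ j) :
    modXPow ℤ (l + 1) (factor f j) = 1 := by
  have h0 : modXPow ℤ (l + 1) (atPow f j) = 0 := by
    rw [← map_zero (modXPow ℤ (l + 1)), modXPow_eq_iff]
    intro m hm
    rw [coeff_atPow_eq_zero hf (by omega), map_zero]
  simpa [h0] using congrArg (modXPow ℤ (l + 1)) (one_sub_mul_factor hf j)

/-- Truncated geometric series: the remainder contains `atPow f j ^ (l + 1)`, divisible by `X ^ (l +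
1)`. -/
theorem modXPow_factor (hf : PowerSeries.constantCoeff f = 0) (l j : ℕ) :
    modXPow ℤ (l + 1) (factor f j) =
      modXPow ℤ (l + 1) (∑ m ∈ Finset.range (l + 1), atPow f j ^ m) := by
  have hX : PowerSeries.X ∣ atPow f j := by
    rw [PowerSeries.X_dvd_iff, ← PowerSeries.coeff_zero_eq_constantCoeff_apply,
      coeff_atPow_eq_zero hf (Nat.succ_pos j)]
  rw [Ideal.Quotient.eq, Ideal.mem_span_singleton]
  have h1 := one_sub_mul_factor hf j
  have h2 := mul_neg_geom_sum (atPow f j) (l + 1)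
  have : factor f j - ∑ m ∈ Finset.range (l + 1), atPow f j ^ m =
      atPow f j ^ (l + 1) * factor f j := by
    linear_combination (∑ m ∈ Finset.range (l + 1), atPow f j ^ m) * h1 - factor f j * h2
  rw [this]
  exact (pow_dvd_pow_of_dvd hX _).mul_right _

/-- Factors with `j ≥ l` are `1` modulo `X ^ (l + 1)`, so this coefficient of the partial products
is eventually constant. -/
theorem dinf_eq_coeff_prod (hf : PowerSeries.constantCoeff f = 0) (l : ℕ) :
    dinf f l = PowerSeries.coeff l (∏ j ∈ Finset.range l, factor f j) := by
  have h := ((PowerSeries.WithPiTopology.continuous_coeff ℤ l).tendsto _).comp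
    (multipliable_factor hf).hasProd.tendsto_prod_nat
  refine tendsto_nhds_unique h (tendsto_const_nhds.congr' ?_)
  filter_upwards [Filter.eventually_ge_atTop l] with n hn
  refine modXPow_eq_iff.1 ?_ l (Nat.lt_succ_self l)
  rw [map_prod, map_prod]
  refine Finset.prod_subset (Finset.range_subset_range.2 hn) fun j _ hj => ?_
  exact modXPow_factor_of_le hf (by simpa using hj)

/-- The series `∏ j, f(q^(j+1))^(μ j)` indexed by multiplicities `μ`. -/
def monomialSeries (f : ℤ⟦X⟧) {K : ℕ} (μ : Fin K → ℕ) : ℤ⟦X⟧ := ∏ j : Fin K, atPow f j ^ μ j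

theorem le_order_atPow {α : ℕ} (hα : f.order = α) (j : ℕ) :
    ((α * (j + 1) : ℕ) : ℕ∞) ≤ (atPow f j).order := by
  refine PowerSeries.nat_le_order _ _ fun n hn => ?_
  rw [atPow, PowerSeries.coeff_expand]
  split_ifs with h
  · obtain ⟨m, rfl⟩ := h
    rw [Nat.mul_div_cancel_left _ j.succ_pos]
    refine PowerSeries.coeff_of_lt_order _ ?_
    rw [hα]
    exact_mod_cast (by nlinarith : m < α)
  · rfl

/-- The source of the bound `α N`: each factor `f(q^k)` has order at least `α k`. -/
theorem weight_le_of_coeff_ne_zero {α : ℕ} (hα : f.order = α) {K l : ℕ} {μ : Fin K → ℕ}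
    (h : PowerSeries.coeff l (monomialSeries f μ) ≠ 0) :
    α * ∑ j : Fin K, ((j : ℕ) + 1) * μ j ≤ l := by
  have h1 : ((α * ∑ j : Fin K, ((j : ℕ) + 1) * μ j : ℕ) : ℕ∞) ≤ (monomialSeries f μ).order := by
    rw [monomialSeries, PowerSeries.order_prod, Finset.mul_sum, Nat.cast_sum]
    refine Finset.sum_le_sum fun j _ => ?_
    rw [PowerSeries.order_pow, nsmul_eq_mul, ← mul_assoc, mul_comm, Nat.cast_mul]
    gcongr
    exact le_order_atPow hα j
  exact_mod_cast h1.trans (PowerSeries.order_le l h)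

theorem dinf_eq_sum (hf : PowerSeries.constantCoeff f = 0) {α : ℕ} (hα : f.order = α)
    (hα0 : 0 < α) (l : ℕ) :
    dinf f l = ∑ m ∈ Finset.range (l + 1), ∑ μ ∈ (Finset.univ : Finset (Fin l)).piAntidiag m,
      PowerSeries.coeff l (monomialSeries f μ) := by
  rw [sum_range_sum_piAntidiag, ← map_sum, dinf_eq_coeff_prod hf]
  · refine modXPow_eq_iff.1 ?_ l (Nat.lt_succ_self l)
    simp only [monomialSeries]
    rw [← Finset.prod_univ_sum, Finset.prod_range, map_prod, map_prod]
    exact Finset.prod_congr rfl fun j _ => modXPow_factor hf l j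
  · intro μ hμ
    by_contra h
    have h1 := weight_le_of_coeff_ne_zero hα h
    have h2 : ∑ j, μ j ≤ ∑ j : Fin l, ((j : ℕ) + 1) * μ j :=
      Finset.sum_le_sum fun j _ => Nat.le_mul_of_pos_left _ (Nat.succ_pos _)
    have h3 := Nat.le_mul_of_pos_left (∑ j : Fin l, ((j : ℕ) + 1) * μ j) hα0
    omega

variable {N : ℕ}

/-- Only `k ≤ l` matter for this coefficient; the multinomial coefficient over `m!` is the inverse
of `∏ (μ j)!`. -/
theorem coeff_integrand_eq_sum (hf : PowerSeries.constantCoeff f = 0) (u : U N) (l : ℕ) :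
    PowerSeries.coeff l (integrand f u) =
      ∑ m ∈ Finset.range (l + 1), ∑ μ ∈ (Finset.univ : Finset (Fin l)).piAntidiag m,
        (∏ j : Fin l, (trPow u (((j : ℕ) + 1 : ℕ) : ℤ) * trPow u (-(((j : ℕ) + 1 : ℕ) : ℤ))) ^ μ j) *
          ((∏ j : Fin l, ((((j : ℕ) + 1 : ℕ) : ℂ) ^ μ j * ((μ j).factorial : ℂ)))⁻¹ *
            ((PowerSeries.coeff l (monomialSeries f μ) : ℤ) : ℂ)) := by
  have hA : modXPow ℂ (l + 1) (action f u) =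
      modXPow ℂ (l + 1) (∑ j : Fin l, actionTerm f u j) := by
    rw [modXPow_eq_iff]
    intro n hn
    rw [coeff_action hf, map_sum, ← Finset.sum_range fun j => PowerSeries.coeff n (actionTerm f u j)]
    refine Finset.sum_subset (Finset.range_subset_range.2 (by omega)) fun j _ hj => ?_
    exact coeff_actionTerm_eq_zero hf u (by simp at hj; omega)
  rw [coeff_integrand hf]
  refine Finset.sum_congr rfl fun m _ => ?_
  have hm : PowerSeries.coeff l (action f u ^ m) =
      PowerSeries.coeff l ((∑ j : Fin l, actionTerm f u j) ^ m) := by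
    refine modXPow_eq_iff.1 ?_ l (Nat.lt_succ_self l)
    rw [map_pow, map_pow, hA]
  rw [hm, Finset.sum_pow_eq_sum_piAntidiag, map_sum, Finset.mul_sum]
  refine Finset.sum_congr rfl fun μ hμ => ?_
  have hspec := Nat.multinomial_spec Finset.univ μ
  rw [(Finset.mem_piAntidiag.1 hμ).1] at hspec
  have hprod : ∏ j : Fin l, actionTerm f u j ^ μ j =
      (∏ j : Fin l, ((1 / (((j : ℕ) + 1 : ℕ) : ℂ)) * (trPow u (((j : ℕ) + 1 : ℕ) : ℤ) *
        trPow u (-(((j : ℕ) + 1 : ℕ) : ℤ)))) ^ μ j) •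
        PowerSeries.map (Int.castRingHom ℂ) (monomialSeries f μ) := by
    simp only [actionTerm, smul_pow, monomialSeries, map_prod, map_pow]
    rw [Finset.prod_smul]
  have hc : ((Nat.multinomial Finset.univ μ : ℕ) : ℂ⟦X⟧) =
      PowerSeries.C (Nat.multinomial Finset.univ μ : ℂ) := by simp
  rw [hprod, hc, PowerSeries.coeff_C_mul, PowerSeries.coeff_smul, PowerSeries.coeff_map, ← hspec]
  have h1 : (∏ j, ((μ j).factorial : ℂ)) ≠ 0 :=
    Finset.prod_ne_zero_iff.2 fun j _ => by exact_mod_cast Nat.factorial_ne_zero _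
  have h2 : (Nat.multinomial Finset.univ μ : ℂ) ≠ 0 := by
    exact_mod_cast (Nat.multinomial_pos _ _).ne'
  simp only [mul_pow, Finset.prod_mul_distrib, one_div, inv_pow, Finset.prod_inv_distrib, mul_inv,
    smul_eq_mul, eq_intCast]
  rw [Nat.cast_mul, Nat.cast_prod, mul_inv]
  generalize (∏ j, ((μ j).factorial : ℂ)) = a at *
  field_simp

open MeasureTheory in
theorem d_eq_sum (hf : PowerSeries.constantCoeff f = 0) {α : ℕ} (hα : f.order = α)
    (hα0 : 0 < α) {l : ℕ} (hl : l ≤ α * N) :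
    d N f l = ∑ m ∈ Finset.range (l + 1), ∑ μ ∈ (Finset.univ : Finset (Fin l)).piAntidiag m,
      ((PowerSeries.coeff l (monomialSeries f μ) : ℤ) : ℂ) := by
  have hint : ∀ μ : Fin l → ℕ, Integrable (fun u : U N => ∏ j : Fin l,
      (trPow u (((j : ℕ) + 1 : ℕ) : ℤ) * trPow u (-(((j : ℕ) + 1 : ℕ) : ℤ))) ^ μ j) (haarU N) :=
    fun μ => integrable_of_continuous <| continuous_finsetProd _ fun j _ =>
      ((continuous_trPow _).mul (continuous_trPow _)).pow _
  rw [d, I, PowerSeries.coeff_mk]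
  simp only [coeff_integrand_eq_sum hf]
  rw [integral_finsetSum _ fun m _ => integrable_finsetSum _ fun μ _ => (hint μ).mul_const _]
  refine Finset.sum_congr rfl fun m _ => ?_
  rw [integral_finsetSum _ fun μ _ => (hint μ).mul_const _]
  refine Finset.sum_congr rfl fun μ _ => ?_
  rw [integral_mul_const]
  -- Outside the stable range the moment is not evaluated, but there the coefficient is zero.
  by_cases h : PowerSeries.coeff l (monomialSeries f μ) = 0
  · simp [h]
  · rw [integral_prod_trPow μ
      (Nat.le_of_mul_le_mul_left ((weight_le_of_coeff_ne_zero hα h).trans hl) hα0),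
      mul_inv_cancel_left₀]
    refine Finset.prod_ne_zero_iff.2 fun j _ => mul_ne_zero (pow_ne_zero _ ?_) ?_
    · exact Nat.cast_ne_zero.2 (Nat.succ_ne_zero _)
    · exact Nat.cast_ne_zero.2 (Nat.factorial_ne_zero _)

end Expansion

end UnitaryMatrixIntegral
end

theorem mainTheorem1 (f : ℤ⟦X⟧) (hf : PowerSeries.constantCoeff f = 0)
    (α : ℕ) (hα : f.order = (α : ℕ∞)) (N : ℕ) (l : ℕ) (hl : l ≤ α * N) :
    UnitaryMatrixIntegral.d N f l = (UnitaryMatrixIntegral.dinf f l : ℂ) := by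
  have hα0 : 0 < α := by
    have h : (1 : ℕ∞) ≤ f.order := by
      rwa [PowerSeries.one_le_order_iff_constCoeff_eq_zero]
    rw [hα] at h
    exact_mod_cast h
  rw [UnitaryMatrixIntegral.d_eq_sum hf hα hα0 hl, UnitaryMatrixIntegral.dinf_eq_sum hf hα hα0]
  push_cast
  rfl
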